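/- Let $D\subset\mathbb R^d$ be open, write $B(z,r)$ for the open ball and, for $x\in\partial D$, put $\mathcal N_{x,r}=\{\mathbf n\in\mathbb R^d:|\mathbf n|=1,\ B(x-r\mathbf n,r)\cap D=\emptyset\}$ and $\mathcal N_x=\bigcup_{r>0}\mathcal N_{x,r}$. Assume: (A) there is $r_0>0$ with $\mathcal N_x=\mathcal N_{x,r_0}\neq\emptyset$ for all $x\in\partial D$; (B) there are $\delta>0$ and $\beta\ge 1$ such that for every $x\in\partial D$ there is a unit vector $l_x$ with $\langle l_x,\mathbf n\rangle\ge 1/\beta$ for all $\mathbf n\in\bigcup_{y\in B(x,\delta)\cap\partial D}\mathcal N_y$. For $\mathrm{dist}(x,\overline D)<r_0$ let $\overline x$ be the point of $\overline D$ nearest to $x$. Let $\kappa$ be a constant such that $|\overline x-\overline y|\le\kappa|x-y|$ whenever $|x-\overline x|<r_0/2$ and $|y-\overline y|<r_0/2$, and put $\gamma=2\kappa^2\beta/r_0$. Let $U\in C^1(\mathbb R^d)$, $U\ge 0$, satisfy $U(x)=|x-\overline x|^2$ whenever $\mathrm{dist}(x,\overline D)\le r_0/2$, and let $\nabla U$ be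 bounded and Lipschitz with constant $2L$, $L\ge 0$. Let $T>0$, $\alpha\in(0,1/2)$, $x_0\in\overline D$, and let $w:[0,T]\to\mathbb R^d$ be continuous with $w_0=0$, $\|w\|_\alpha=\sup_{0\le s<t\le T}|w_t-w_s|/|t-s|^\alpha<\infty$ and $\|w\|_T=\sup_{0\le t\le T}|w_t|$. Put $\lambda(w)=\exp\{\gamma(\|w\|_T+\delta)\}$ and, for an integer $m\ge 1$, $\varepsilon_m^\alpha(w)=12e^{L}m^{-\alpha}\|w\|_\alpha$. Let $\xi^m$ be the continuous solution on $[0,T]$ of $\xi^m_t=x_0+w_t+\phi^m_t$, where $\phi^m_t=-\frac m2\int_0^t\nabla U(\xi^m_s)\,ds$. If $\varepsilon_m^\alpha(w)<\min\{\delta/(180\beta\lambda(w)),\ r_0/2\}$, then the total variation $|\phi^m|_T$ of $\phi^m$ on $[0,T]$ satisfies $$|\phi^m|_T\le C_0\left(\|w\|_\alpha^{1+1/\alpha}+\|w\|_\alpha\right)\exp\{\gamma(1+1/\alpha)\|w\|_T\},\qquad C_0=C_1\exp\{\gamma(1+1/\alpha)\delta\},$$ where $C_1>0$ depends only on $\alpha,\beta,L,\delta$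 and $T$. -/

import Mathlib

open Set MeasureTheory
open scoped NNReal ENNReal

noncomputable section

namespace SkorohodPenalization

/-- `ℝ^d` with its Euclidean norm. -/
abbrev Space (d : ℕ) : Type := EuclideanSpace ℝ (Fin d)

variable {d : ℕ}

/-- The unit vectors `n` such that the open ball `B(x - r n, r)` does not meet `D`. -/
def normalsOfRadius (D : Set (Space d)) (x : Space d) (r : ℝ) : Set (Space d) :=
  {n | ‖n‖ = 1 ∧ Metric.ball (x - r • n) r ∩ D = ∅}

/-- The inward unit normals of `D` at `x`: the union of `normalsOfRadius D x r` over `r > 0`. -/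
def normals (D : Set (Space d)) (x : Space d) : Set (Space d) :=
  ⋃ r ∈ Ioi (0 : ℝ), normalsOfRadius D x r

/-- Condition (A) with constant `r₀`: a uniform exterior ball condition. -/
def ConditionA (D : Set (Space d)) (r₀ : ℝ) : Prop :=
  0 < r₀ ∧ ∀ x ∈ frontier D,
    normals D x = normalsOfRadius D x r₀ ∧ (normalsOfRadius D x r₀).Nonempty

/-- Condition (B) with constants `δ` and `β`. -/
def ConditionB (D : Set (Space d)) (δ β : ℝ) : Prop :=
  0 < δ ∧ 1 ≤ β ∧ ∀ x ∈ frontier D, ∃ l : Space d, ‖l‖ = 1 ∧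
    ∀ y ∈ Metric.ball x δ ∩ frontier D, ∀ n ∈ normals D y, 1 / β ≤ inner ℝ l n

/-- `p` is a projection of `x` on `closure D`: a point of `closure D` nearest to `x`. -/
def IsProjection (D : Set (Space d)) (x p : Space d) : Prop :=
  p ∈ closure D ∧ dist x p = Metric.infDist x (closure D)

/-- `κ` is a Lipschitz constant of the projection on `closure D` over the points at distance
less than `r` from `closure D`. -/
def IsProjectionLipschitzConstant (D : Set (Space d)) (r κ : ℝ) : Prop :=
  ∀ x y p q : Space d, IsProjection D x p → IsProjection D y q →
    dist x p < r → dist y q < r → dist p q ≤ κ * dist x y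

/-- `U` is a penalization function for `D`: it is `C¹` and nonnegative, it is the squared distance
to `closure D` where that distance is at most `r₀ / 2`, and its gradient is bounded and
`2 L`-Lipschitz. -/
structure IsPenaltyFunction (D : Set (Space d)) (r₀ : ℝ) (L : ℝ≥0) (U : Space d → ℝ) : Prop where
  contDiff : ContDiff ℝ 1 U
  nonneg : ∀ x, 0 ≤ U x
  eq_sq_dist : ∀ x p, IsProjection D x p → dist x p ≤ r₀ / 2 → U x = dist x p ^ 2
  gradient_bounded : ∃ M : ℝ, ∀ x, ‖gradient U x‖ ≤ M
  gradient_lipschitz : LipschitzWith (2 * L) (gradient U)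

/-- The set of `α`-Hölder quotients of `w` on `[0, T]`. -/
def holderQuotients (α T : ℝ) (w : ℝ → Space d) : Set ℝ :=
  {q | ∃ s t : ℝ, 0 ≤ s ∧ s < t ∧ t ≤ T ∧ q = ‖w t - w s‖ / |t - s| ^ α}

/-- `w` is `α`-Hölder continuous on `[0, T]`: the supremum of its Hölder quotients is finite. -/
def IsHolderOn (α T : ℝ) (w : ℝ → Space d) : Prop :=
  BddAbove (holderQuotients α T w)

/-- `‖w‖_α`, the `α`-Hölder seminorm of `w` on `[0, T]`. -/
def holderNorm (α T : ℝ) (w : ℝ → Space d) : ℝ :=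
  sSup (holderQuotients α T w)

/-- `‖w‖_T`, the supremum of `|w_t|` over `[0, T]`. -/
def supNorm (T : ℝ) (w : ℝ → Space d) : ℝ :=
  sSup ((fun t => ‖w t‖) '' Icc 0 T)

/-- `ε_m^α(w) = 12 e^L ‖w‖_α / m^α`. -/
def epsilon (α T : ℝ) (L : ℝ≥0) (m : ℕ) (w : ℝ → Space d) : ℝ :=
  12 * Real.exp L / (m : ℝ) ^ α * holderNorm α T w

/-- `γ = 2 κ² β / r₀`. -/
def gammaConst (κ β r₀ : ℝ) : ℝ := 2 * κ ^ 2 * β / r₀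

/-- `λ(w) = exp (γ (‖w‖_T + δ))`. -/
def lambdaConst (γ δ T : ℝ) (w : ℝ → Space d) : ℝ :=
  Real.exp (γ * (supNorm T w + δ))

/-- The penalization term `φ_t = -(m/2) ∫₀ᵗ ∇U(ξ_s) ds`. -/
def penaltyTerm (U : Space d → ℝ) (m : ℕ) (ξ : ℝ → Space d) (t : ℝ) : Space d :=
  -(((m : ℝ) / 2) • ∫ s in (0 : ℝ)..t, gradient U (ξ s))

/-- `ξ` is a continuous solution on `[0, T]` of
`ξ_t = x₀ + w_t - (m/2) ∫₀ᵗ ∇U(ξ_s) ds`. -/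
def IsPenalizedSolution (U : Space d → ℝ) (m : ℕ) (T : ℝ) (x₀ : Space d) (w ξ : ℝ → Space d) :
    Prop :=
  ContinuousOn ξ (Icc 0 T) ∧ ∀ t ∈ Icc (0 : ℝ) T, ξ t = x₀ + w t + penaltyTerm U m ξ t

end SkorohodPenalization

end

namespace SkorohodPenalization

variable {d : ℕ} {D : Set (Space d)}

/-! Near `closure D` the penalization has velocity `m (p - ξ)`, `p` being the projection of `ξ`;
this is a multiple of an inward normal at `p`. Three facts give the bound. Over a time `1 / m` the
penalization contracts the distance to `closure D` by a factor `1 / e`, so this distance stays below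
a multiple of `‖w‖_α m ^ (-α)` (`infDist_le_of_penalized`). On an interval where `w` oscillates by
at most a small `ω`, condition (B) bounds the arc length of `φ` by `β` times its increment, while
condition (A) gives a Gronwall inequality for the squared increment, with arc length as clock.
Together they bound the arc length linearly in `ω` and the distance (`arcLength_penalty_le`). Hölder
continuity makes of order `‖w‖_α ^ (1 / α)` equal intervals suffice; adding up the local bounds
yields the power `1 + 1 / α`. -/

/-! ### Projections on `closure D` and exterior balls. -/

lemma exists_isProjection (hD : (closure D).Nonempty) (x : Space d) : ∃ p, IsProjection D x p := by
  obtain ⟨p, hp, h⟩ := isClosed_closure.exists_infDist_eq_dist hD x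
  exact ⟨p, hp, h.symm⟩

lemma IsProjection.dist_le {x p y : Space d} (h : IsProjection D x p) (hy : y ∈ closure D) :
    dist x p ≤ dist x y :=
  h.2 ▸ Metric.infDist_le_dist_of_mem hy

/-- A point between `x` and its projection has the same projection. -/
lemma IsProjection.segment {x p : Space d} (h : IsProjection D x p) {θ : ℝ} (h0 : 0 ≤ θ)
    (h1 : θ ≤ 1) : IsProjection D (p + θ • (x - p)) p := by
  refine ⟨h.1, le_antisymm ?_ (Metric.infDist_le_dist_of_mem h.1)⟩
  refine (Metric.le_infDist ⟨p, h.1⟩).2 fun y hy => ?_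
  have e1 : dist (p + θ • (x - p)) p = θ * dist x p := by
    rw [dist_eq_norm, dist_eq_norm, add_sub_cancel_left, norm_smul, Real.norm_of_nonneg h0]
  have e2 : dist x (p + θ • (x - p)) = (1 - θ) * dist x p := by
    have : x - (p + θ • (x - p)) = (1 - θ) • (x - p) := by module
    rw [dist_eq_norm, dist_eq_norm, this, norm_smul, Real.norm_of_nonneg (by linarith)]
  have := dist_triangle x (p + θ • (x - p)) y
  have := h.dist_le hy
  linarith

/-- The projection need not be differentiated: with `p` frozen, `‖y - p‖ ^ 2` dominates `U y` near
`x` with equality at `x`, so the two gradients agree there. -/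
lemma IsPenaltyFunction.gradient_eq {r₀ : ℝ} {L : ℝ≥0} {U : Space d → ℝ}
    (hU : IsPenaltyFunction D r₀ L U) {x p : Space d} (h : IsProjection D x p)
    (hx : dist x p < r₀ / 2) : gradient U x = (2 : ℝ) • (x - p) := by
  have hdU : HasFDerivAt U (fderiv ℝ U x) x :=
    ((hU.contDiff.differentiable one_ne_zero) x).hasFDerivAt
  have hsq : HasFDerivAt (fun y : Space d => ‖y - p‖ ^ 2) (2 • innerSL ℝ (x - p)) x := by
    simpa using ((hasFDerivAt_id x).sub_const p).norm_sq
  have hmin : IsLocalMin (fun y => ‖y - p‖ ^ 2 - U y) x := by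
    have hev : ∀ᶠ y in nhds x, Metric.infDist y (closure D) < r₀ / 2 :=
      (Metric.continuous_infDist_pt (closure D)).continuousAt.eventually_lt_const
        (show Metric.infDist x (closure D) < r₀ / 2 from h.2 ▸ hx)
    filter_upwards [hev] with y hy
    obtain ⟨q, hq⟩ := exists_isProjection ⟨p, h.1⟩ y
    have hqp := hq.dist_le h.1
    rw [hU.eq_sq_dist x p h hx.le, hU.eq_sq_dist y q hq (hq.2 ▸ hy.le), ← dist_eq_norm,
      ← dist_eq_norm]
    have := pow_le_pow_left₀ dist_nonneg hqp 2
    linarith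
  have hz := hmin.hasFDerivAt_eq_zero (hsq.sub hdU)
  refine ext_inner_right ℝ fun v => ?_
  have hv := congrArg (fun A : Space d →L[ℝ] ℝ => A v) hz
  simp only [sub_apply, smul_apply, innerSL_apply_apply,
    zero_apply, nsmul_eq_mul, Nat.cast_ofNat] at hv
  rw [gradient, InnerProductSpace.toDual_symm_apply, real_inner_smul_left]
  linarith

lemma IsProjection.ball_inter_eq_empty {x p : Space d} (h : IsProjection D x p) :
    Metric.ball x (dist x p) ∩ D = ∅ := by
  refine eq_empty_of_forall_notMem fun y hy => ?_
  have h1 := h.dist_le (subset_closure hy.2)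
  have h2 := Metric.mem_ball'.1 hy.1
  linarith

lemma IsProjection.mem_frontier (hD : IsOpen D) {x p : Space d} (h : IsProjection D x p)
    (hne : x ≠ p) : p ∈ frontier D := by
  rw [hD.frontier_eq]
  refine ⟨h.1, fun hp => ?_⟩
  have hc : p ∈ closure (Metric.ball x (dist x p)) := by
    rw [closure_ball x (dist_pos.2 hne).ne']
    exact (dist_comm p x).le
  obtain ⟨y, hy⟩ := mem_closure_iff.1 hc D hD hp
  exact (h.ball_inter_eq_empty ▸ (⟨hy.2, hy.1⟩ : y ∈ _ ∩ D) : y ∈ (∅ : Set (Space d)))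

lemma IsProjection.mem_normals {x p : Space d} (h : IsProjection D x p) (hne : x ≠ p) :
    ‖p - x‖⁻¹ • (p - x) ∈ normals D p := by
  have hpos : 0 < ‖p - x‖ := norm_pos_iff.2 (sub_ne_zero.2 hne.symm)
  refine mem_iUnion₂.2 ⟨‖p - x‖, hpos, ?_, ?_⟩
  · rw [norm_smul, norm_inv, norm_norm, inv_mul_cancel₀ hpos.ne']
  · rw [smul_inv_smul₀ hpos.ne', sub_sub_cancel, ← dist_eq_norm, dist_comm]
    exact h.ball_inter_eq_empty

/-- Since `y` lies outside the ball of radius `r₀` about `p - r₀ • n`, expanding the squared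
distance to the centre gives the bound. -/
lemma inner_normal_le {r₀ : ℝ} (hA : ConditionA D r₀) {p n y : Space d} (hp : p ∈ frontier D)
    (hn : n ∈ normals D p) (hy : y ∈ closure D) :
    inner ℝ (p - y) n ≤ ‖p - y‖ ^ 2 / (2 * r₀) := by
  have hr := hA.1
  rw [(hA.2 p hp).1] at hn
  have hdist : r₀ ≤ ‖(p - y) - r₀ • n‖ := by
    have hsub : closure D ⊆ (Metric.ball (p - r₀ • n) r₀)ᶜ :=
      closure_minimal (fun z hz hz' => (hn.2 ▸ (⟨hz', hz⟩ : z ∈ _ ∩ D) : z ∈ (∅ : Set (Space d))))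
        Metric.isOpen_ball.isClosed_compl
    have := hsub hy
    rw [mem_compl_iff, Metric.mem_ball', not_lt, dist_eq_norm] at this
    rwa [show p - r₀ • n - y = p - y - r₀ • n by abel] at this
  have hsq := pow_le_pow_left₀ hr.le hdist 2
  rw [norm_sub_sq_real, norm_smul, hn.1, real_inner_smul_right, Real.norm_of_nonneg hr.le] at hsq
  rw [le_div_iff₀ (by positivity)]
  nlinarith

lemma IsProjection.inner_le (hD : IsOpen D) {r₀ : ℝ} (hA : ConditionA D r₀) {x p y : Space d}
    (h : IsProjection D x p) (hy : y ∈ closure D) :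
    inner ℝ (p - y) (p - x) ≤ ‖p - x‖ * (‖p - y‖ ^ 2 / (2 * r₀)) := by
  rcases eq_or_ne x p with rfl | hne
  · simp
  have hpos : 0 < ‖p - x‖ := norm_pos_iff.2 (sub_ne_zero.2 hne.symm)
  have := inner_normal_le hA (h.mem_frontier hD hne) (h.mem_normals hne) hy
  rw [real_inner_smul_right, inv_mul_le_iff₀ hpos] at this
  exact this

lemma IsProjection.le_inner (hD : IsOpen D) {δ β : ℝ} {z l : Space d}
    (hl : ∀ y ∈ Metric.ball z δ ∩ frontier D, ∀ n ∈ normals D y, 1 / β ≤ inner ℝ l n)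
    {x p : Space d} (h : IsProjection D x p) (hp : p ∈ Metric.ball z δ) :
    1 / β * ‖p - x‖ ≤ inner ℝ l (p - x) := by
  rcases eq_or_ne x p with rfl | hne
  · simp
  have hpos : 0 < ‖p - x‖ := norm_pos_iff.2 (sub_ne_zero.2 hne.symm)
  have := hl p ⟨hp, h.mem_frontier hD hne⟩ _ (h.mem_normals hne)
  rw [real_inner_smul_right, ← div_eq_inv_mul, le_div_iff₀ hpos] at this
  exact this

/-! ### Distance from the penalized path to `closure D`. -/

/-- Over a time step, a penalized solution stays close to the flow of the penalization alone. -/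
lemma norm_sub_flow_le {r₀ : ℝ} {L : ℝ≥0} {U : Space d → ℝ} (hU : IsPenaltyFunction D r₀ L U)
    {m : ℕ} {x₀ : Space d} {w ξ φ : ℝ → Space d} {s t a : ℝ} (hst : s ≤ t)
    (hφ : ∀ u, HasDerivAt φ (-(((m : ℝ) / 2) • gradient U (ξ u))) u)
    (hξ : ∀ u ∈ Icc s t, ξ u = x₀ + w u + φ u)
    (hw : ∀ u ∈ Icc s t, ‖w u - w s‖ ≤ a) {p : Space d} (hp : IsProjection D (ξ s) p)
    (hpr : dist (ξ s) p < r₀ / 2) :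
    ‖ξ t - (p + Real.exp (-(m * (t - s))) • (ξ s - p))‖ ≤ a * Real.exp (m * L * (t - s)) := by
  have hs : s ∈ Icc s t := left_mem_Icc.2 hst
  have ht : t ∈ Icc s t := right_mem_Icc.2 hst
  -- Explicit flow of the penalization alone: it runs along the segment to `p`, where the projection
  -- remains `p`.
  set y : ℝ → Space d := fun u => p + Real.exp (-(m * (u - s))) • (ξ s - p) with hy
  have hyd : ∀ u, HasDerivAt y ((-(m : ℝ) * Real.exp (-(m * (u - s)))) • (ξ s - p)) u := by
    intro u
    have h1 : HasDerivAt (fun u : ℝ => -((m : ℝ) * (u - s))) (-(m : ℝ)) u :=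
      (((hasDerivAt_id u).sub_const s).const_mul (m : ℝ)).neg.congr_deriv (by ring)
    have := (h1.exp.smul_const (ξ s - p)).const_add p
    rwa [mul_comm] at this
  have hygrad : ∀ u ∈ Icc s t, gradient U (y u) = (2 : ℝ) • (y u - p) := by
    intro u hu
    have hle : Real.exp (-(m * (u - s))) ≤ 1 := by
      rw [Real.exp_le_one_iff, neg_nonpos]
      exact mul_nonneg m.cast_nonneg (by linarith [hu.1])
    refine hU.gradient_eq (hp.segment (Real.exp_nonneg _) hle) (lt_of_le_of_lt ?_ hpr)
    rw [dist_eq_norm, dist_eq_norm, add_sub_cancel_left, norm_smul,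
      Real.norm_of_nonneg (Real.exp_nonneg _)]
    exact mul_le_of_le_one_left (norm_nonneg _) hle
  -- Gronwall is applied to the differentiable part of `ξ - y`; the remaining part is the increment
  -- of `w`, bounded by `a`.
  set g : ℝ → Space d := fun u => φ u - φ s - (y u - ξ s) with hg
  have hys : y s = ξ s := by simp [hy]
  have hgs : g s = 0 := by simp [hg, hys]
  have hgd : ∀ u ∈ Icc s t,
      HasDerivAt g (-(((m : ℝ) / 2) • (gradient U (ξ u) - gradient U (y u)))) u := by
    intro u hu
    refine (((hφ u).sub_const (φ s)).sub ((hyd u).sub_const (ξ s))).congr_deriv ?_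
    rw [hygrad u hu]
    simp only [hy]
    module
  have hdec : ∀ u ∈ Icc s t, ξ u - y u = (w u - w s) + g u := by
    intro u hu
    rw [hg, hξ u hu]
    simp only
    rw [hξ s hs]
    abel
  have hnorm : ∀ u ∈ Icc s t, ‖ξ u - y u‖ ≤ a + ‖g u‖ := fun u hu => by
    rw [hdec u hu]
    exact (norm_add_le _ _).trans (add_le_add_left (hw u hu) _)
  have hbound : ∀ u ∈ Ico s t, ‖-(((m : ℝ) / 2) • (gradient U (ξ u) - gradient U (y u)))‖
      ≤ (m * L) * ‖g u‖ + (m * L) * a := by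
    intro u hu
    have h1 := hU.gradient_lipschitz.dist_le_mul (ξ u) (y u)
    rw [dist_eq_norm, dist_eq_norm] at h1
    push_cast at h1
    rw [norm_neg, norm_smul, Real.norm_of_nonneg (by positivity)]
    have h2 := hnorm u ⟨hu.1, hu.2.le⟩
    calc (m : ℝ) / 2 * ‖gradient U (ξ u) - gradient U (y u)‖
        ≤ (m : ℝ) / 2 * (2 * L * (a + ‖g u‖)) := by
          gcongr
          exact h1.trans (by gcongr)
      _ = _ := by ring
  have hgr := norm_le_gronwallBound_of_norm_deriv_right_le (δ := 0)
    (fun u hu => (hgd u hu).continuousAt.continuousWithinAt)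
    (fun u hu => (hgd u ⟨hu.1, hu.2.le⟩).hasDerivWithinAt) (by rw [hgs, norm_zero]) hbound t ht
  have hgb : gronwallBound 0 (m * L) (m * L * a) (t - s) = a * (Real.exp (m * L * (t - s)) - 1) := by
    rcases eq_or_ne ((m : ℝ) * L) 0 with h0 | h0
    · simp [h0, gronwallBound_K0]
    · rw [gronwallBound_of_K_ne_0 h0, mul_div_cancel_left₀ _ h0]
      ring
  rw [hgb] at hgr
  have := hnorm t ht
  linarith

/-- A penalized solution started in `closure D` stays close to `closure D`. -/
lemma infDist_le_of_penalized {r₀ : ℝ} {L : ℝ≥0} {U : Space d → ℝ}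
    (hU : IsPenaltyFunction D r₀ L U) {m : ℕ} (hm : 1 ≤ m) {x₀ : Space d} (hx₀ : x₀ ∈ closure D)
    {w ξ φ : ℝ → Space d} {T a : ℝ} (ha : 0 ≤ a)
    (hφ : ∀ u, HasDerivAt φ (-(((m : ℝ) / 2) • gradient U (ξ u))) u)
    (hξ : ∀ u ∈ Icc 0 T, ξ u = x₀ + w u + φ u) (h0 : ξ 0 = x₀)
    (hw : ∀ s ∈ Icc 0 T, ∀ u ∈ Icc 0 T, s ≤ u → u - s ≤ 1 / m → ‖w u - w s‖ ≤ a)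
    (har : 2 * (a * Real.exp L) < r₀ / 2) :
    ∀ t ∈ Icc 0 T, Metric.infDist (ξ t) (closure D) ≤ 2 * (a * Real.exp L) := by
  have hm0 : (0 : ℝ) < m := by exact_mod_cast hm
  have hstep : ∀ s t, 0 ≤ s → s ≤ t → t ≤ T → t - s ≤ 1 / m →
      Metric.infDist (ξ s) (closure D) ≤ 2 * (a * Real.exp L) →
      Metric.infDist (ξ t) (closure D) ≤
        a * Real.exp L + Real.exp (-(m * (t - s))) * Metric.infDist (ξ s) (closure D) := by
    intro s t hs hst htT hd hi
    obtain ⟨p, hp⟩ := exists_isProjection ⟨x₀, hx₀⟩ (ξ s)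
    have h1 := norm_sub_flow_le hU hst hφ (fun u hu => hξ u ⟨hs.trans hu.1, hu.2.trans htT⟩)
      (fun u hu => hw s ⟨hs, hst.trans htT⟩ u ⟨hs.trans hu.1, hu.2.trans htT⟩ hu.1
        (by linarith [hu.2])) hp (by rw [hp.2]; linarith)
    have h2 : a * Real.exp (m * L * (t - s)) ≤ a * Real.exp L := by
      gcongr
      have : (m : ℝ) * (t - s) ≤ 1 := by rwa [le_div_iff₀' hm0] at hd
      nlinarith [L.2]
    have h3 := Metric.infDist_le_dist_of_mem (x := ξ t) hp.1
    have h4 := dist_triangle (ξ t) (p + Real.exp (-(m * (t - s))) • (ξ s - p)) p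
    have h5 : dist (p + Real.exp (-(m * (t - s))) • (ξ s - p)) p
        = Real.exp (-(m * (t - s))) * Metric.infDist (ξ s) (closure D) := by
      rw [← hp.2, dist_eq_norm, dist_eq_norm, add_sub_cancel_left, norm_smul,
        Real.norm_of_nonneg (Real.exp_nonneg _)]
    rw [← dist_eq_norm] at h1
    linarith
  have he : 0 ≤ a * Real.exp L := by positivity
  have hz : Metric.infDist (ξ 0) (closure D) = 0 := by
    rw [h0]; exact Metric.infDist_zero_of_mem hx₀
  have hind : ∀ k : ℕ, ∀ t ∈ Icc 0 T, t ≤ k / m →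
      Metric.infDist (ξ t) (closure D) ≤ 2 * (a * Real.exp L) := by
    intro k
    induction k with
    | zero =>
      intro t ht htk
      have : t = 0 := le_antisymm (by simpa using htk) ht.1
      rw [this, hz]
      linarith
    | succ k ih =>
      intro t ht htk
      rcases le_total t (1 / m) with h | h
      · have := hstep 0 t le_rfl ht.1 ht.2 (by linarith) (by rw [hz]; linarith)
        rw [hz] at this
        linarith
      · have h1m : (0 : ℝ) < 1 / m := by positivity
        have hs := ih (t - 1 / m) ⟨by linarith, by linarith [ht.2]⟩ (by
          push_cast at htk
          rw [add_div] at htk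
          linarith)
        have := hstep (t - 1 / m) t (by linarith) (by linarith) ht.2 (by linarith) hs
        -- A full step at least halves the old distance, so the level `2 * (a * exp L)` reproduces
        -- itself.
        have hexp : Real.exp (-(m * (t - (t - 1 / m)))) ≤ 1 / 2 := by
          have : (m : ℝ) * (t - (t - 1 / m)) = 1 := by field_simp; ring
          rw [this, Real.exp_neg, inv_le_comm₀ (Real.exp_pos _) (by norm_num)]
          have := Real.add_one_le_exp (1 : ℝ)
          norm_num at this ⊢
          linarith
        have := mul_le_mul hexp hs Metric.infDist_nonneg (by norm_num)
        linarith
  intro t ht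
  obtain ⟨k, hk⟩ := exists_nat_ge (t * m)
  exact hind k t ht (by rwa [le_div_iff₀ hm0])

/-! ### Arc length of the penalization on one interval. -/

/-- Continuity argument: at the first time `g` reaches `c`, the weak bound holds up to then, and its
strict improvement is a contradiction. -/
lemma forall_lt_of_continuous {g : ℝ → ℝ} (hg : Continuous g) {s t c : ℝ} (h0 : g s < c)
    (h : ∀ u ∈ Icc s t, (∀ v ∈ Icc s u, g v ≤ c) → g u < c) : ∀ u ∈ Icc s t, g u < c := by
  by_contra! hcon
  obtain ⟨u, hu, huc⟩ := hcon
  have hK : IsCompact (Icc s t ∩ g ⁻¹' Ici c) :=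
    isCompact_Icc.inter_right (isClosed_Ici.preimage hg)
  obtain ⟨z, hz, hzmin⟩ := hK.exists_isLeast ⟨u, hu, huc⟩
  refine (h z hz.1 fun v hv => ?_).not_ge hz.2
  by_contra! hvc
  obtain ⟨r, hr, hrc⟩ := intermediate_value_Icc hv.1 hg.continuousOn ⟨h0.le, hvc.le⟩
  have hrv : r ≠ v := fun hrv => by rw [hrv] at hrc; exact hvc.ne' hrc
  have := hzmin ⟨⟨hr.1, hr.2.trans (hv.2.trans hz.1.2)⟩, hrc.ge⟩
  exact hrv (le_antisymm hr.2 (hv.2.trans this))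

/-- A Gronwall bound with respect to the arc length `ψ` of `φ`. -/
lemma norm_sq_le_of_inner_le {φ v : ℝ → Space d} {ψ : ℝ → ℝ} {s t k b : ℝ} (hst : s ≤ t)
    (hφ : ∀ u, HasDerivAt φ (v u) u) (hψ : ∀ u, HasDerivAt ψ ‖v u‖ u) (hk : 0 ≤ k) (hb : 0 ≤ b)
    (hin : ∀ u ∈ Icc s t, inner ℝ (φ u - φ s) (v u) ≤ ‖v u‖ * (k * ‖φ u - φ s‖ ^ 2 + b)) :
    ‖φ t - φ s‖ ^ 2 ≤ 2 * b * (ψ t - ψ s) * Real.exp (2 * k * (ψ t - ψ s)) := by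
  have hψm : Monotone ψ := monotone_of_hasDerivAt_nonneg hψ fun u => norm_nonneg _
  -- Integrating factor in the clock `ψ`. As the factor is at most `1`, subtracting `2 * b * (ψ u -
  -- ψ s)` makes `F` nonincreasing.
  set F : ℝ → ℝ := fun u =>
    ‖φ u - φ s‖ ^ 2 * Real.exp (-(2 * k * (ψ u - ψ s))) - 2 * b * (ψ u - ψ s) with hF
  have hFd : ∀ u, HasDerivAt F (2 * inner ℝ (φ u - φ s) (v u) *
      Real.exp (-(2 * k * (ψ u - ψ s))) + ‖φ u - φ s‖ ^ 2 *
      (Real.exp (-(2 * k * (ψ u - ψ s))) * (-(2 * k * ‖v u‖))) - 2 * b * ‖v u‖) u := fun u =>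
    ((((hφ u).sub_const (φ s)).norm_sq.mul
      (((hψ u).sub_const (ψ s)).const_mul (2 * k)).neg.exp)).sub
      (((hψ u).sub_const (ψ s)).const_mul (2 * b))
  have hanti : AntitoneOn F (Icc s t) := by
    refine antitoneOn_of_deriv_nonpos (convex_Icc s t)
      (fun u _ => (hFd u).continuousAt.continuousWithinAt)
      (fun u _ => (hFd u).differentiableAt.differentiableWithinAt) fun u hu => ?_
    have hu' : u ∈ Icc s t := interior_subset hu
    rw [(hFd u).deriv]
    have hE0 := Real.exp_pos (-(2 * k * (ψ u - ψ s)))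
    have hE1 : Real.exp (-(2 * k * (ψ u - ψ s))) ≤ 1 := by
      rw [Real.exp_le_one_iff, neg_nonpos]
      have := hψm hu'.1
      exact mul_nonneg (by positivity) (by linarith)
    have h1 := mul_le_mul_of_nonneg_right (hin u hu') hE0.le
    have h2 : b * ‖v u‖ * Real.exp (-(2 * k * (ψ u - ψ s))) ≤ b * ‖v u‖ :=
      mul_le_of_le_one_right (by positivity) hE1
    nlinarith
  have h := hanti (left_mem_Icc.2 hst) (right_mem_Icc.2 hst) hst
  have hFs : F s = 0 := by simp [hF]
  rw [hFs] at h
  simp only [hF, Real.exp_neg] at h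
  have hE := Real.exp_pos (2 * k * (ψ t - ψ s))
  rw [sub_nonpos, ← div_eq_mul_inv, div_le_iff₀ hE] at h
  exact h

lemma gammaConst_nonneg {κ β r₀ : ℝ} (hβ : 0 ≤ β) (hr : 0 ≤ r₀) : 0 ≤ gammaConst κ β r₀ := by
  unfold gammaConst
  positivity

/-- If the direction of `φ` stays in a cone, then its arc length `ψ` is controlled by its
increment. -/
lemma arcLength_le_of_cone {φ v : ℝ → Space d} {ψ : ℝ → ℝ} {s t β : ℝ} (hst : s ≤ t) (hβ : 0 < β)
    (hφ : ∀ u, HasDerivAt φ (v u) u) (hψ : ∀ u, HasDerivAt ψ ‖v u‖ u) {l : Space d} (hl : ‖l‖ ≤ 1)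
    (hv : ∀ u ∈ Icc s t, 1 / β * ‖v u‖ ≤ inner ℝ l (v u)) :
    ψ t - ψ s ≤ β * ‖φ t - φ s‖ := by
  -- The component of `φ` along `l` grows at least as fast as `ψ / β`.
  have hGd : ∀ u, HasDerivAt (fun u => inner ℝ l (φ u) - 1 / β * ψ u)
      (inner ℝ l (v u) - 1 / β * ‖v u‖) u := fun u =>
    ((innerSL ℝ l).hasFDerivAt.comp_hasDerivAt u (hφ u)).sub ((hψ u).const_mul (1 / β))
  have hmono : MonotoneOn (fun u => inner ℝ l (φ u) - 1 / β * ψ u) (Icc s t) := by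
    refine monotoneOn_of_deriv_nonneg (convex_Icc s t)
      (fun u _ => (hGd u).continuousAt.continuousWithinAt)
      (fun u _ => (hGd u).differentiableAt.differentiableWithinAt) fun u hu => ?_
    rw [(hGd u).deriv]
    linarith [hv u (interior_subset hu)]
  have h := hmono (left_mem_Icc.2 hst) (right_mem_Icc.2 hst) hst
  have h1 : inner ℝ l (φ t - φ s) ≤ ‖φ t - φ s‖ :=
    (real_inner_le_norm _ _).trans (mul_le_of_le_one_left (norm_nonneg _) hl)
  rw [inner_sub_right] at h1
  rw [← div_le_iff₀' hβ, div_eq_mul_one_div]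
  simp only at h
  linarith

/-- The arc length of the penalization term over an interval on which the driving path
oscillates little. -/
lemma arcLength_penalty_le {r₀ δ β κ : ℝ} {L : ℝ≥0} {U : Space d → ℝ} (hD : IsOpen D)
    (hA : ConditionA D r₀) (hB : ConditionB D δ β)
    (hκ : IsProjectionLipschitzConstant D (r₀ / 2) κ) (hU : IsPenaltyFunction D r₀ L U)
    {m : ℕ} {x₀ : Space d} {w ξ φ p : ℝ → Space d} {ψ : ℝ → ℝ} {s t ω e : ℝ} (hst : s ≤ t)
    (hφ : ∀ u, HasDerivAt φ (-(((m : ℝ) / 2) • gradient U (ξ u))) u)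
    (hψ : ∀ u, HasDerivAt ψ ‖-(((m : ℝ) / 2) • gradient U (ξ u))‖ u)
    (hξ : ∀ u ∈ Icc s t, ξ u = x₀ + w u + φ u)
    (hp : ∀ u ∈ Icc s t, IsProjection D (ξ u) (p u))
    (he : ∀ u ∈ Icc s t, dist (ξ u) (p u) ≤ e) (her : e < r₀ / 2)
    (hw : ∀ u ∈ Icc s t, ‖w u - w s‖ ≤ ω)
    (hωδ : ω * (β * Real.exp (gammaConst κ β r₀ * δ / 2)) ≤ δ / 100)
    (heδ : e * (β * Real.exp (gammaConst κ β r₀ * δ / 2)) ≤ δ / 100) :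
    ψ t - ψ s ≤ β ^ 2 * (3 * ω + 2 * e) * Real.exp (gammaConst κ β r₀ * δ / 2) := by
  obtain ⟨hδ, hβ, hB⟩ := hB
  have hr := hA.1
  have hβ0 : 0 < β := by linarith
  set γ := gammaConst κ β r₀ with hγ
  have hγ0 : 0 ≤ γ := gammaConst_nonneg hβ0.le hr.le
  set Λ := Real.exp (γ * δ / 2) with hΛ
  have hΛ1 : 1 ≤ Λ := Real.one_le_exp (by positivity)
  have hsm : s ∈ Icc s t := left_mem_Icc.2 hst
  have hω0 : 0 ≤ ω := (norm_nonneg _).trans (hw s hsm)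
  have he0 : 0 ≤ e := dist_nonneg.trans (he s hsm)
  have hβΛ : 1 ≤ β * Λ := one_le_mul_of_one_le_of_one_le hβ hΛ1
  have hω1 : ω ≤ δ / 100 := (le_mul_of_one_le_right hω0 hβΛ).trans hωδ
  have he1 : e ≤ δ / 100 := (le_mul_of_one_le_right he0 hβΛ).trans heδ
  have hm0 : (0 : ℝ) ≤ m := m.cast_nonneg
  have hv : ∀ u ∈ Icc s t, -(((m : ℝ) / 2) • gradient U (ξ u)) = (m : ℝ) • (p u - ξ u) := by
    intro u hu
    rw [hU.gradient_eq (hp u hu) ((he u hu).trans_lt her)]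
    module
  have hξs : ∀ u ∈ Icc s t, ξ u - ξ s = (w u - w s) + (φ u - φ s) := by
    intro u hu
    rw [hξ u hu, hξ s hsm]
    abel
  have hξn : ∀ u ∈ Icc s t, ‖ξ u - ξ s‖ ≤ ω + ‖φ u - φ s‖ := fun u hu => by
    rw [hξs u hu]
    exact (norm_add_le _ _).trans (add_le_add_left (hw u hu) _)
  have hin : ∀ u ∈ Icc s t, inner ℝ (φ u - φ s) (-(((m : ℝ) / 2) • gradient U (ξ u))) ≤
      ‖-(((m : ℝ) / 2) • gradient U (ξ u))‖ *
        (κ ^ 2 / r₀ * ‖φ u - φ s‖ ^ 2 + (κ ^ 2 / r₀ * ω ^ 2 + e + ω)) := by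
    intro u hu
    rw [hv u hu, real_inner_smul_right, norm_smul, Real.norm_of_nonneg hm0, mul_assoc]
    refine mul_le_mul_of_nonneg_left ?_ hm0
    set q := p u - ξ u with hq
    -- Paired with `q`, the first term is nonpositive, the second is quadratic by the exterior ball
    -- and the Lipschitz projection, and the last two cost `e` and `ω`.
    have h1 : φ u - φ s = -q + (p u - p s) + (p s - ξ s) + -(w u - w s) := by
      rw [eq_sub_of_add_eq' (hξs u hu).symm, hq]
      abel
    have hqq : inner ℝ (-q) q ≤ 0 := by
      rw [inner_neg_left, real_inner_self_eq_norm_sq]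
      nlinarith [norm_nonneg q]
    have h2 : inner ℝ (p u - p s) q ≤ ‖q‖ * (κ ^ 2 / r₀ * ‖φ u - φ s‖ ^ 2 + κ ^ 2 / r₀ * ω ^ 2) := by
      refine ((hp u hu).inner_le hD hA (hp s hsm).1).trans
        (mul_le_mul_of_nonneg_left ?_ (norm_nonneg _))
      have h3 := hκ _ _ _ _ (hp u hu) (hp s hsm) ((he u hu).trans_lt her) ((he s hsm).trans_lt her)
      rw [dist_eq_norm, dist_eq_norm] at h3
      have h4 := pow_le_pow_left₀ (norm_nonneg _) h3 2
      have h5 := pow_le_pow_left₀ (norm_nonneg _) (hξn u hu) 2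
      have h6 : (ω + ‖φ u - φ s‖) ^ 2 ≤ 2 * (‖φ u - φ s‖ ^ 2 + ω ^ 2) := by
        nlinarith [sq_nonneg (ω - ‖φ u - φ s‖)]
      rw [div_le_iff₀ (by positivity)]
      have h7 : (κ ^ 2 / r₀ * ‖φ u - φ s‖ ^ 2 + κ ^ 2 / r₀ * ω ^ 2) * (2 * r₀) =
          κ ^ 2 * (2 * (‖φ u - φ s‖ ^ 2 + ω ^ 2)) := by
        field_simp
      rw [h7]
      rw [mul_pow] at h4
      exact h4.trans (mul_le_mul_of_nonneg_left (h5.trans h6) (sq_nonneg κ))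
    have h3 : inner ℝ (p s - ξ s) q ≤ ‖q‖ * e := by
      rw [mul_comm]
      refine (real_inner_le_norm _ _).trans (mul_le_mul_of_nonneg_right ?_ (norm_nonneg _))
      rw [← dist_eq_norm, dist_comm]
      exact he s hsm
    have h4 : inner ℝ (-(w u - w s)) q ≤ ‖q‖ * ω := by
      rw [mul_comm]
      refine (real_inner_le_norm _ _).trans (mul_le_mul_of_nonneg_right ?_ (norm_nonneg _))
      rw [norm_neg]
      exact hw u hu
    have h5 : inner ℝ (φ u - φ s) q = inner ℝ (-q) q + inner ℝ (p u - p s) q +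
        inner ℝ (p s - ξ s) q + inner ℝ (-(w u - w s)) q := by
      rw [h1, inner_add_left, inner_add_left, inner_add_left]
    rw [h5]
    linarith
  have hcone : ∀ u ∈ Icc s t, (∀ r ∈ Icc s u, ‖φ r - φ s‖ ≤ δ / 4) →
      ψ u - ψ s ≤ β * ‖φ u - φ s‖ := by
    intro u hu hr4
    have hsub : Icc s u ⊆ Icc s t := Icc_subset_Icc_right hu.2
    -- If the path leaves `closure D` at `z`, then `p z` is a frontier point and every `p r` is
    -- within `2 * e + 2 * ω + δ / 2 < δ` of it, so one vector `l` serves the whole interval.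
    -- Otherwise the velocity vanishes and `l = 0` will do.
    by_cases hex : ∃ z ∈ Icc s u, ξ z ≠ p z
    · obtain ⟨z, hz, hne⟩ := hex
      obtain ⟨l, hl1, hl⟩ := hB (p z) ((hp z (hsub hz)).mem_frontier hD hne)
      refine arcLength_le_of_cone hu.1 hβ0 hφ hψ hl1.le fun r hr' => ?_
      have hball : p r ∈ Metric.ball (p z) δ := by
        rw [Metric.mem_ball]
        have h1 := dist_triangle4 (p r) (ξ r) (ξ z) (p z)
        have h2 := dist_triangle (ξ r) (ξ s) (ξ z)
        have h3 := hξn r (hsub hr')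
        have h4 := hξn z (hsub hz)
        rw [← dist_eq_norm] at h3 h4
        rw [dist_comm (ξ s)] at h2
        have h5 := he r (hsub hr')
        rw [dist_comm] at h5
        linarith [he z (hsub hz), hr4 r hr', hr4 z hz]
      have := (hp r (hsub hr')).le_inner hD hl hball
      rw [hv r (hsub hr'), real_inner_smul_right, norm_smul, Real.norm_of_nonneg hm0,
        mul_left_comm]
      exact mul_le_mul_of_nonneg_left this hm0
    · push Not at hex
      refine arcLength_le_of_cone (l := 0) hu.1 hβ0 hφ hψ (by simp) fun r hr' => ?_
      rw [hv r (hsub hr'), hex r hr']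
      simp
  have hkey : ∀ u ∈ Icc s t, (∀ r ∈ Icc s u, ‖φ r - φ s‖ ≤ δ / 4) →
      ‖φ u - φ s‖ ≤ β * (3 * ω + 2 * e) * Λ := by
    intro u hu hr4
    rcases (norm_nonneg (φ u - φ s)).eq_or_lt with h0 | hpos
    · rw [← h0]
      positivity
    have h1 := norm_sq_le_of_inner_le hu.1 hφ hψ (by positivity) (by positivity)
      fun r hr' => hin r ⟨hr'.1, hr'.2.trans hu.2⟩
    have h2 := hcone u hu hr4
    have hu4 := hr4 u (right_mem_Icc.2 hu.1)
    have hγk : γ = 2 * (κ ^ 2 / r₀) * β := by rw [hγ, gammaConst]; ring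
    have hexp : Real.exp (2 * (κ ^ 2 / r₀) * (ψ u - ψ s)) ≤ Real.exp (γ * δ / 4) := by
      rw [Real.exp_le_exp]
      calc 2 * (κ ^ 2 / r₀) * (ψ u - ψ s) ≤ 2 * (κ ^ 2 / r₀) * (β * (δ / 4)) := by
            gcongr
            exact h2.trans (by gcongr)
        _ = γ * δ / 4 := by rw [hγk]; ring
    have h3 : ‖φ u - φ s‖ ^ 2 ≤ 2 * (κ ^ 2 / r₀ * ω ^ 2 + e + ω) * (β * ‖φ u - φ s‖) *
        Real.exp (γ * δ / 4) := by
      refine h1.trans ?_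
      gcongr
    -- The arc length in the Gronwall bound is at most `β * ‖φ u - φ s‖`, so one factor of the
    -- square cancels.
    have h4 : ‖φ u - φ s‖ ≤ (γ * ω * ω + 2 * β * (e + ω)) * Real.exp (γ * δ / 4) := by
      refine le_of_mul_le_mul_right ?_ hpos
      calc ‖φ u - φ s‖ * ‖φ u - φ s‖ = ‖φ u - φ s‖ ^ 2 := by ring
        _ ≤ _ := h3
        _ = _ := by rw [hγk]; ring
    have hΛ2 : Real.exp (γ * δ / 4) * Real.exp (γ * δ / 4) = Λ := by
      rw [hΛ, ← Real.exp_add]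
      congr 1
      ring
    -- One factor `γ * ω` is traded for a second `exp (γ * δ / 4)`, whence the exponent `γ * δ / 2`
    -- in `Λ`.
    have h5 : γ * ω ≤ Real.exp (γ * δ / 4) := by
      have := Real.add_one_le_exp (γ * δ / 4)
      have : γ * ω ≤ γ * (δ / 100) := mul_le_mul_of_nonneg_left hω1 hγ0
      have : 0 ≤ γ * δ := by positivity
      linarith
    have h6 : Real.exp (γ * δ / 4) ≤ Λ := by
      rw [hΛ, Real.exp_le_exp]
      have : 0 ≤ γ * δ := by positivity
      linarith
    calc ‖φ u - φ s‖ ≤ γ * ω * ω * Real.exp (γ * δ / 4) +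
          2 * β * (e + ω) * Real.exp (γ * δ / 4) := by rw [← add_mul]; exact h4
      _ ≤ Real.exp (γ * δ / 4) * ω * Real.exp (γ * δ / 4) + 2 * β * (e + ω) * Λ := by gcongr
      _ = ω * Λ + 2 * β * (e + ω) * Λ := by rw [← hΛ2]; ring
      _ ≤ β * ω * Λ + 2 * β * (e + ω) * Λ := by
          gcongr
          exact le_mul_of_one_le_left hω0 hβ
      _ = _ := by ring
  have hφc : Continuous φ := continuous_iff_continuousAt.2 fun u => (hφ u).continuousAt
  -- The bootstrap closes because `β * (3 * ω + 2 * e) * Λ ≤ 5 * δ / 100 < δ / 4`.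
  have hsmall : ∀ u ∈ Icc s t, ‖φ u - φ s‖ < δ / 4 :=
    forall_lt_of_continuous (g := fun u => ‖φ u - φ s‖) (by fun_prop) (by simpa using hδ)
      fun u hu h => (hkey u hu h).trans_lt (by linarith)
  have h4 : ∀ r ∈ Icc s t, ‖φ r - φ s‖ ≤ δ / 4 := fun r hr => (hsmall r hr).le
  have htm : t ∈ Icc s t := right_mem_Icc.2 hst
  calc ψ t - ψ s ≤ β * ‖φ t - φ s‖ := hcone t htm h4
    _ ≤ β * (β * (3 * ω + 2 * e) * Λ) := mul_le_mul_of_nonneg_left (hkey t htm h4) hβ0.le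
    _ = _ := by ring

/-! ### Hölder oscillation and summation over a uniform partition. -/

lemma holderNorm_nonneg (α T : ℝ) (w : ℝ → Space d) : 0 ≤ holderNorm α T w := by
  refine Real.sSup_nonneg ?_
  rintro q ⟨s, t, -, -, -, rfl⟩
  positivity

lemma supNorm_nonneg (T : ℝ) (w : ℝ → Space d) : 0 ≤ supNorm T w := by
  refine Real.sSup_nonneg ?_
  rintro q ⟨t, -, rfl⟩
  positivity

lemma IsHolderOn.norm_sub_le {α T : ℝ} {w : ℝ → Space d} (hw : IsHolderOn α T w) (hα : 0 ≤ α)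
    {s t h : ℝ} (hs : 0 ≤ s) (hst : s ≤ t) (ht : t ≤ T) (hh : t - s ≤ h) :
    ‖w t - w s‖ ≤ holderNorm α T w * h ^ α := by
  have hH := holderNorm_nonneg α T w
  rcases hst.eq_or_lt with rfl | hlt
  · rw [sub_self, norm_zero]
    have : 0 ≤ h := by linarith
    positivity
  have hpos : 0 < t - s := sub_pos.2 hlt
  have h1 : ‖w t - w s‖ / |t - s| ^ α ≤ holderNorm α T w :=
    le_csSup hw ⟨s, t, hs, hlt, ht, rfl⟩
  rw [abs_of_pos hpos, div_le_iff₀ (by positivity)] at h1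
  exact h1.trans (by gcongr)

/-- Increments of `φ` are dominated by those of the monotone `ψ`, whose variation is its total
increment. -/
lemma eVariationOn_le_of_hasDerivAt {φ v : ℝ → Space d} {ψ : ℝ → ℝ}
    (hφ : ∀ u, HasDerivAt φ (v u) u) (hψ : ∀ u, HasDerivAt ψ ‖v u‖ u) {a b : ℝ} (hab : a ≤ b) :
    eVariationOn φ (Icc a b) ≤ ENNReal.ofReal (ψ b - ψ a) := by
  have hψm : Monotone ψ := monotone_of_hasDerivAt_nonneg hψ fun u => norm_nonneg _
  have hle : ∀ s t, s ≤ t → ‖φ t - φ s‖ ≤ ψ t - ψ s := fun s t hst =>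
    image_norm_le_of_norm_deriv_right_le_deriv_boundary (f := fun u => φ u - φ s)
      (B := fun u => ψ u - ψ s)
      (fun u _ => ((hφ u).sub_const _).continuousAt.continuousWithinAt)
      (fun u _ => ((hφ u).sub_const _).hasDerivWithinAt) (by simp)
      (fun u => (hψ u).sub_const _) (fun u _ => le_rfl) (right_mem_Icc.2 hst)
  have h1 : eVariationOn φ (Icc a b) ≤ eVariationOn ψ (Icc a b) := by
    refine iSup_le fun q => ?_
    refine le_trans (Finset.sum_le_sum fun i _ => ?_) (eVariationOn.sum_le q.2.2.1 fun i => q.2.2.2 i)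
    rw [edist_dist, edist_dist, dist_eq_norm, Real.dist_eq]
    exact ENNReal.ofReal_le_ofReal ((hle _ _ (q.2.2.1 i.le_succ)).trans (le_abs_self _))
  refine h1.trans ?_
  have := (hψm.monotoneOn (Icc a b)).eVariationOn_eq (left_mem_Icc.2 hab) (right_mem_Icc.2 hab)
  rw [inter_self] at this
  exact this.le

lemma sub_le_nat_mul_of_uniform {ψ : ℝ → ℝ} {h M : ℝ} {N : ℕ}
    (hM : ∀ i < N, ψ ((i + 1 : ℕ) * h) - ψ (i * h) ≤ M) : ψ (N * h) - ψ 0 ≤ N * M := by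
  have h1 := Finset.sum_le_card_nsmul (Finset.range N)
    (fun i : ℕ => ψ ((i + 1 : ℕ) * h) - ψ (i * h)) M fun i hi => hM i (Finset.mem_range.1 hi)
  rw [Finset.sum_range_sub (fun i : ℕ => ψ (i * h))] at h1
  simpa using h1

/-- The variation of the penalization term over `[0, T]`, when the driving path oscillates by at
most `ω` on each of the `N` intervals of a uniform partition. -/
lemma eVariationOn_penaltyTerm_le {α r₀ δ β κ T : ℝ} {L : ℝ≥0} {U : Space d → ℝ} (hα : 0 ≤ α)
    (hT : 0 < T) (hD : IsOpen D) (hA : ConditionA D r₀) (hB : ConditionB D δ β)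
    (hκ : IsProjectionLipschitzConstant D (r₀ / 2) κ) (hU : IsPenaltyFunction D r₀ L U)
    {m : ℕ} (hm : 1 ≤ m) {x₀ : Space d} (hx₀ : x₀ ∈ closure D) {w ξ : ℝ → Space d} (hw0 : w 0 = 0)
    (hw : IsHolderOn α T w) (hξ : IsPenalizedSolution U m T x₀ w ξ) {e : ℝ}
    (hedef : e = 2 * (holderNorm α T w / (m : ℝ) ^ α * Real.exp L)) (her : e < r₀ / 2)
    (heδ : e * (β * Real.exp (gammaConst κ β r₀ * δ / 2)) ≤ δ / 100) {N : ℕ} (hN : 1 ≤ N)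
    (hωδ : holderNorm α T w * (T / N) ^ α *
      (β * Real.exp (gammaConst κ β r₀ * δ / 2)) ≤ δ / 100) :
    eVariationOn (penaltyTerm U m ξ) (Icc 0 T) ≤ ENNReal.ofReal
      (N * (β ^ 2 * (3 * (holderNorm α T w * (T / N) ^ α) + 2 * e) *
        Real.exp (gammaConst κ β r₀ * δ / 2))) := by
  have hm0 : (0 : ℝ) < m := by exact_mod_cast hm
  have hN0 : (0 : ℝ) < N := by exact_mod_cast hN
  have hH := holderNorm_nonneg α T w
  -- Extending `ξ` by constants makes the velocity continuous on the whole line, so `φ` and `ψ` are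
  -- differentiable everywhere.
  set η : ℝ → Space d := IccExtend hT.le (fun t => ξ t) with hη
  have hηξ : ∀ t ∈ Icc 0 T, η t = ξ t := fun t ht => IccExtend_of_mem hT.le _ ht
  have hηc : Continuous η := (continuousOn_iff_continuous_domRestrict.1 hξ.1).Icc_extend'
  set v : ℝ → Space d := fun u => -(((m : ℝ) / 2) • gradient U (η u)) with hv
  have hvc : Continuous v := by
    have := hU.gradient_lipschitz.continuous.comp hηc
    exact (this.const_smul ((m : ℝ) / 2)).neg
  set φ : ℝ → Space d := fun t => ∫ u in (0 : ℝ)..t, v u with hφdef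
  set ψ : ℝ → ℝ := fun t => ∫ u in (0 : ℝ)..t, ‖v u‖ with hψdef
  have hφ : ∀ u, HasDerivAt φ (v u) u := fun u => hvc.integral_hasStrictDerivAt 0 u |>.hasDerivAt
  have hψ : ∀ u, HasDerivAt ψ ‖v u‖ u := fun u =>
    hvc.norm.integral_hasStrictDerivAt 0 u |>.hasDerivAt
  have hpen : ∀ t ∈ Icc 0 T, penaltyTerm U m ξ t = φ t := by
    intro t ht
    rw [hφdef, penaltyTerm]
    simp only [hv]
    rw [intervalIntegral.integral_neg, intervalIntegral.integral_smul]
    congr 2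
    refine intervalIntegral.integral_congr fun u hu => ?_
    rw [uIcc_of_le ht.1] at hu
    simp only [hηξ u ⟨hu.1, hu.2.trans ht.2⟩]
  have hηeq : ∀ u ∈ Icc 0 T, η u = x₀ + w u + φ u := fun u hu => by
    rw [hηξ u hu, hξ.2 u hu, hpen u hu]
  have hη0 : η 0 = x₀ := by
    rw [hηeq 0 (left_mem_Icc.2 hT.le), hw0, hφdef]
    simp
  have hinf : ∀ t ∈ Icc 0 T, Metric.infDist (η t) (closure D) ≤ e := by
    rw [hedef]
    refine infDist_le_of_penalized hU hm hx₀ (by positivity) hφ hηeq hη0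
      (fun s hs u hu hsu hd => ?_) (hedef ▸ her)
    have := hw.norm_sub_le hα hs.1 hsu hu.2 hd
    rwa [Real.div_rpow zero_le_one hm0.le, Real.one_rpow, mul_one_div] at this
  choose p hp using fun u => exists_isProjection ⟨x₀, hx₀⟩ (η u)
  rw [eVariationOn.congr hpen]
  refine (eVariationOn_le_of_hasDerivAt hφ hψ hT.le).trans (ENNReal.ofReal_le_ofReal ?_)
  have hpart := sub_le_nat_mul_of_uniform (ψ := ψ) (h := T / N) (N := N)
    (M := β ^ 2 * (3 * (holderNorm α T w * (T / N) ^ α) + 2 * e) *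
        Real.exp (gammaConst κ β r₀ * δ / 2)) fun i hi => by
    have hh : 0 < T / N := by positivity
    have h0 : 0 ≤ (i : ℝ) * (T / N) := by positivity
    have hlen : ((i + 1 : ℕ) : ℝ) * (T / N) = i * (T / N) + T / N := by push_cast; ring
    have hend : ((i + 1 : ℕ) : ℝ) * (T / N) ≤ T := by
      have : ((i + 1 : ℕ) : ℝ) ≤ N := by exact_mod_cast hi
      calc ((i + 1 : ℕ) : ℝ) * (T / N) ≤ N * (T / N) := by gcongr
        _ = T := by field_simp
    have hsub : ∀ u ∈ Icc ((i : ℝ) * (T / N)) ((i + 1 : ℕ) * (T / N)), u ∈ Icc 0 T := fun u hu =>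
      ⟨h0.trans hu.1, hu.2.trans hend⟩
    exact arcLength_penalty_le hD hA hB hκ hU (by rw [hlen]; linarith) hφ hψ
      (fun u hu => hηeq u (hsub u hu)) (fun u _ => hp u)
      (fun u hu => (hp u).2 ▸ hinf u (hsub u hu)) her
      (fun u hu => hw.norm_sub_le hα h0 hu.1 (hsub u hu).2 (by linarith [hu.2])) hωδ heδ
  rwa [mul_div_cancel₀ T hN0.ne'] at hpart

/-- A number of intervals that makes the oscillation of a Hölder path small on each of them. -/
lemma mul_rpow_div_floor_le {α T c : ℝ} (hα : 0 < α) (hT : 0 < T) (hc : 0 ≤ c) :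
    c * (T / (⌊T * c ^ (1 / α)⌋₊ + 1 : ℕ)) ^ α ≤ 1 := by
  have hN : (0 : ℝ) < (⌊T * c ^ (1 / α)⌋₊ + 1 : ℕ) := by positivity
  have hlt : T * c ^ (1 / α) < (⌊T * c ^ (1 / α)⌋₊ + 1 : ℕ) := by
    push_cast
    exact Nat.lt_floor_add_one _
  have hc' : c = (c ^ (1 / α)) ^ α := by
    rw [← Real.rpow_mul hc, one_div_mul_cancel hα.ne', Real.rpow_one]
  nth_rewrite 1 [hc']
  rw [← Real.mul_rpow (by positivity) (by positivity)]
  refine Real.rpow_le_one (by positivity) ?_ hα.le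
  rw [mul_div_assoc', div_le_one hN]
  linarith

end SkorohodPenalization

/-! ### Choice of the partition and of the constant. -/

theorem mainTheorem3 (α β δ T : ℝ) (L : ℝ≥0) (hα₀ : 0 < α) (hα : α < 1 / 2) (hβ : 1 ≤ β)
    (hδ : 0 < δ) (hT : 0 < T) :
    ∃ C₁ : ℝ, 0 < C₁ ∧
      ∀ (d : ℕ) (D : Set (SkorohodPenalization.Space d)) (r₀ κ : ℝ)
        (U : SkorohodPenalization.Space d → ℝ) (x₀ : SkorohodPenalization.Space d)
        (w ξ : ℝ → SkorohodPenalization.Space d) (m : ℕ),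
        IsOpen D →
        SkorohodPenalization.ConditionA D r₀ →
        SkorohodPenalization.ConditionB D δ β →
        SkorohodPenalization.IsProjectionLipschitzConstant D (r₀ / 2) κ →
        SkorohodPenalization.IsPenaltyFunction D r₀ L U →
        x₀ ∈ closure D →
        ContinuousOn w (Icc 0 T) →
        w 0 = 0 →
        SkorohodPenalization.IsHolderOn α T w →
        1 ≤ m →
        SkorohodPenalization.epsilon α T L m w <
          min (δ / (180 * β * SkorohodPenalization.lambdaConst
            (SkorohodPenalization.gammaConst κ β r₀) δ T w)) (r₀ / 2) →
        SkorohodPenalization.IsPenalizedSolution U m T x₀ w ξ →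
        eVariationOn (SkorohodPenalization.penaltyTerm U m ξ) (Icc 0 T) ≤
          ENNReal.ofReal
            (C₁ * Real.exp (SkorohodPenalization.gammaConst κ β r₀ * (1 + 1 / α) * δ) *
              (SkorohodPenalization.holderNorm α T w ^ (1 + 1 / α) +
                SkorohodPenalization.holderNorm α T w) *
              Real.exp (SkorohodPenalization.gammaConst κ β r₀ * (1 + 1 / α) *
                SkorohodPenalization.supNorm T w)) := by
  have hδβ : 0 ≤ 100 * β / δ := by positivity
  -- The first bracket comes from `3 * ω + 2 * e` with `ω ≤ H * T ^ α` and `e ≤ 2 * H * exp L`; the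
  -- second comes from the number of intervals.
  refine ⟨β ^ 2 * (3 * T ^ α + 4 * Real.exp L) * (T * (100 * β / δ) ^ (1 / α) + 1),
    by positivity, ?_⟩
  intro d D r₀ κ U x₀ w ξ m hD hA hB hκ hU hx₀ _ hw0 hw hm hε hξ
  have hr := hA.1
  have hm1 : (1 : ℝ) ≤ m := by exact_mod_cast hm
  have hm0 : (0 : ℝ) < m := by linarith
  have hH := SkorohodPenalization.holderNorm_nonneg α T w
  have hS := SkorohodPenalization.supNorm_nonneg T w
  have hγ := SkorohodPenalization.gammaConst_nonneg (κ := κ) (zero_le_one.trans hβ) hr.le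
  have hvar := fun e he => SkorohodPenalization.eVariationOn_penaltyTerm_le hα₀.le hT hD hA hB hκ
    hU hm hx₀ hw0 hw hξ (e := e) he
  rw [lt_min_iff, SkorohodPenalization.epsilon, SkorohodPenalization.lambdaConst] at hε
  generalize SkorohodPenalization.holderNorm α T w = H at *
  generalize SkorohodPenalization.supNorm T w = S at *
  generalize SkorohodPenalization.gammaConst κ β r₀ = γ at *
  set Λ := Real.exp (γ * δ / 2) with hΛ
  set e := 2 * (H / (m : ℝ) ^ α * Real.exp L) with he
  have he0 : 0 ≤ e := by positivity
  have hε6 : 12 * Real.exp L / (m : ℝ) ^ α * H = 6 * e := by rw [he]; ring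
  rw [hε6, lt_div_iff₀ (by positivity)] at hε
  have hΛγ : Λ ≤ Real.exp (γ * (S + δ)) := by
    rw [hΛ, Real.exp_le_exp]
    nlinarith [mul_nonneg hγ hS, mul_nonneg hγ hδ.le]
  have heδ : e * (β * Λ) ≤ δ / 100 := by
    have h1 : e * (β * Λ) ≤ e * (β * Real.exp (γ * (S + δ))) := by gcongr
    have h2 : 0 ≤ e * (β * Real.exp (γ * (S + δ))) := by positivity
    linarith [hε.1]
  have heH : e ≤ 2 * (H * Real.exp L) := by
    have h1 : H / (m : ℝ) ^ α ≤ H := div_le_self hH (Real.one_le_rpow hm1 hα₀.le)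
    rw [he]
    gcongr
  -- Chosen so that `c * (T / N) ^ α ≤ 1` is exactly the smallness of the oscillation required on
  -- each interval.
  set c := 100 * β / δ * Λ * H with hc
  have hc0 : 0 ≤ c := by positivity
  set N := ⌊T * c ^ (1 / α)⌋₊ + 1 with hN
  have hN1 : (1 : ℝ) ≤ N := by exact_mod_cast Nat.le_add_left 1 _
  have hNle : (N : ℝ) ≤ T * c ^ (1 / α) + 1 := by
    rw [hN]
    push_cast
    gcongr
    exact Nat.floor_le (by positivity)
  have hωδ : H * (T / N) ^ α * (β * Λ) ≤ δ / 100 := by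
    have h1 := SkorohodPenalization.mul_rpow_div_floor_le hα₀ hT hc0
    rw [← hN] at h1
    have h2 : H * (T / N) ^ α * (β * Λ) = δ / 100 * (c * (T / N) ^ α) := by
      rw [hc]
      field_simp
    rw [h2]
    exact mul_le_of_le_one_right (by positivity) h1
  refine (hvar e he (by linarith [hε.2]) heδ (Nat.le_add_left 1 _) hωδ).trans
    (ENNReal.ofReal_le_ofReal ?_)
  have hTN : T / N ≤ T := div_le_self hT.le hN1
  set E := Real.exp (γ * (1 + 1 / α) * δ) with hE
  have hα1 : 0 ≤ 1 / α := by positivity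
  have hΛE : Λ ≤ E := by
    rw [hΛ, hE, Real.exp_le_exp]
    nlinarith [mul_nonneg hγ hδ.le, mul_nonneg (mul_nonneg hγ hδ.le) hα1]
  -- The factor `Λ ^ (1 / α)` comes from the number of intervals, the other `Λ` from the bound on
  -- each.
  have hΛE' : Λ ^ (1 / α) * Λ ≤ E := by
    rw [hΛ, hE, ← Real.exp_mul, ← Real.exp_add, Real.exp_le_exp]
    nlinarith [mul_nonneg hγ hδ.le, mul_nonneg (mul_nonneg hγ hδ.le) hα1]
  have hHp : H ^ (1 + 1 / α) = H * H ^ (1 / α) := by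
    rw [Real.rpow_add_of_nonneg hH zero_le_one hα1, Real.rpow_one]
  have hcp : c ^ (1 / α) = (100 * β / δ) ^ (1 / α) * Λ ^ (1 / α) * H ^ (1 / α) := by
    rw [hc, Real.mul_rpow (by positivity) hH, Real.mul_rpow hδβ (Real.exp_nonneg _)]
  set A := (100 * β / δ) ^ (1 / α) with hA'
  have hA0 : 0 ≤ A := by positivity
  set B := β ^ 2 * (3 * T ^ α + 4 * Real.exp L) with hB'
  have hB0 : 0 ≤ B := by positivity
  have hHp0 : 0 ≤ H ^ (1 + 1 / α) := by positivity
  calc (N : ℝ) * (β ^ 2 * (3 * (H * (T / N) ^ α) + 2 * e) * Λ)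
      ≤ (T * c ^ (1 / α) + 1) * (β ^ 2 * (3 * (H * T ^ α) + 2 * (2 * (H * Real.exp L))) * Λ) := by
        gcongr
    _ = B * (T * A * H ^ (1 + 1 / α) * (Λ ^ (1 / α) * Λ) + H * Λ) := by
        rw [hcp, hHp, hB']
        ring
    _ ≤ B * (T * A * H ^ (1 + 1 / α) * E + H * E) := by gcongr
    _ ≤ B * (T * A * (H ^ (1 + 1 / α) + H) * E + (H ^ (1 + 1 / α) + H) * E) := by
        gcongr
        · linarith
        · linarith
    _ = B * (T * A + 1) * E * (H ^ (1 + 1 / α) + H) := by ring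
    _ ≤ _ := by
        -- The local bounds do not involve `‖w‖_T`; its exponential is at least `1` and only
        -- enlarges the right side.
        refine le_mul_of_one_le_right (by positivity) (Real.one_le_exp (by positivity))
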